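/- For $f\in L^2(\mathbb R)$ (complex-valued), $f\neq 0$, let $$\mu(f)=\frac1{\|f\|_2^2}\int_{\mathbb R}t\,|f(t)|^2\,dt,\qquad \Delta^2(f)=\int_{\mathbb R}|t-\mu(f)|^2|f(t)|^2\,dt\in[0,\infty]$$ be its mean and its variance, with the convention that $\Delta^2(f)=+\infty$ and $\mu(f)=0$ when $t\,|f(t)|^2$ is not integrable. Let $\widehat f$ be the Fourier transform, the extension to $L^2(\mathbb R)$ of $\widehat f(\xi)=\int_{\mathbb R}f(x)e^{-2i\pi x\xi}\,dx$ from $L^1(\mathbb R)\cap L^2(\mathbb R)$. For $k\ge 0$ let $$h_k(t)=\frac{2^{1/4}}{\sqrt{k!}}\left(-\frac1{2\sqrt{\pi}}\right)^k e^{\pi t^2}\left(\frac{d}{dt}\right)^k e^{-2\pi t^2}$$ be the Hermite functions, normalized in $L^2(\mathbb R)$. **Theorem (Jaming-Powell).** Let $(e_k)_{k\ge 0}$ be an orthonormal sequence in $L^2(\mathbb R)$. Then for all $n\ge 0$, $$\sum_{k=0}^n\left(\Delta^2(e_k)+\Delta^2(\widehat{e_k})+|\mu(e_k)|^2+|\mu(\widehat{e_k})|^2\right)\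 \ge\ \frac{(n+1)^2}{2\pi}.$$ Moreover, for every $n_0\ge 0$, if equality holds for all $n$ with $0\le n\le n_0$, then for each $k=0,\dots,n_0$ there is $c_k\in\mathbb C$ with $|c_k|=1$ and $e_k=c_kh_k$ almost everywhere. -/

import Mathlib

open MeasureTheory
open scoped ENNReal FourierTransform

/-- The complex Hilbert space `L²(ℝ)`. Mathlib's Fourier transform `𝓕` on it is the unitary extension
of `𝓕 f ξ = ∫ f x * exp (-2 π i x ξ) dx`. -/
abbrev L2R : Type := Lp (α := ℝ) ℂ 2 volume

/-- The mean `μ(f) = ‖f‖⁻² ∫ t |f t|² dt`. If `t |f t|²` is not integrable, the integral takes the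
default value `0`; in that case `variance f = ∞`, so the default value plays no role in
`variance f + |mean f|²`. -/
noncomputable def L2R.mean (f : L2R) : ℝ :=
  1 / ‖f‖ ^ 2 * ∫ t : ℝ, t * ‖f t‖ ^ 2

/-- The variance `Δ²(f) = ∫ |t - μ(f)|² |f t|² dt`, with values in `[0, ∞]`. -/
noncomputable def L2R.variance (f : L2R) : ℝ≥0∞ :=
  ∫⁻ t : ℝ, ENNReal.ofReal (|t - L2R.mean f| ^ 2 * ‖f t‖ ^ 2)

/-- The Hermite functions
`h_k(t) = 2^(1/4) / √(k!) * (-1 / (2 √π))^k * exp (π t²) * (d/dt)^k exp (-2 π t²)`,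
normalized in `L²(ℝ)`. -/
noncomputable def hermiteFunction (k : ℕ) (t : ℝ) : ℝ :=
  (2 : ℝ) ^ (1 / 4 : ℝ) / √(k.factorial : ℝ) * (-1 / (2 * √Real.pi)) ^ k *
    Real.exp (Real.pi * t ^ 2) *
    iteratedDeriv k (fun s : ℝ => Real.exp (-2 * Real.pi * s ^ 2)) t

open scoped SchwartzMap Polynomial

/-! ### The Gaussian as a Schwartz function -/

/-! For a unit vector `f`, variance plus squared mean is the second moment, so the quantity attached
to `f` is the energy of the harmonic oscillator, which the Hermite functions diagonalize: if finite,
it equals `(1/2π) ∑ (2j+1) |⟨h_j, f⟩|²` (`hasSum_sq_norm_coeff_of_moments`). No derivative of `f` is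
needed: multiplication by `t` acts on Hermite coefficients by a two-term recurrence, and `𝓕 h_j =
(-i)^j h_j` flips the relative sign of the two terms, so cross terms cancel between `f` and `𝓕 f`.

Summing over `N` orthonormal vectors gives weights `a_j = ∑_k |⟨h_j, e_k⟩|²`, at most `1` by Bessel
and of total mass `N` by Parseval. The sum `∑ (2j+1) a_j` is least when the mass fills the first `N`
levels, where it is `1 + 3 + ⋯ + (2N-1) = N²` (`sq_le_of_hasSum_two_mul_add_one_mul`).

Under equality, successive differences give `e_n` energy exactly `2n+1`. Inductively `e_n` is
orthogonal to `h_j` for `j < n`, so no mass can lie above level `n` either.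

Parseval needs completeness of the Hermite functions, which follows from vanishing Gaussian moments
and injectivity of the Fourier transform. -/

theorem hasDerivAt_exp_mul_sq (c x : ℝ) :
    HasDerivAt (fun t : ℝ => Real.exp (c * t ^ 2)) (2 * c * x * Real.exp (c * x ^ 2)) x := by
  have h := (((hasDerivAt_id x).pow 2).const_mul c).exp
  convert! h using 1
  simp
  ring

theorem exists_polynomial_iteratedDeriv_gaussian (n : ℕ) :
    ∃ P : ℝ[X], iteratedDeriv n (fun x : ℝ => Real.exp (-Real.pi * x ^ 2)) =
      fun x => P.eval x * Real.exp (-Real.pi * x ^ 2) := by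
  induction n with
  | zero => exact ⟨1, by ext x; simp⟩
  | succ n ih =>
    obtain ⟨P, hP⟩ := ih
    refine ⟨P.derivative + P * (Polynomial.C (2 * -Real.pi) * Polynomial.X), ?_⟩
    ext x
    have h : HasDerivAt (fun x => P.eval x * Real.exp (-Real.pi * x ^ 2)) _ x :=
      (P.hasDerivAt x).mul (hasDerivAt_exp_mul_sq (-Real.pi) x)
    rw [iteratedDeriv_succ, hP, h.deriv]
    simp
    ring

theorem exists_bound_pow_mul_polynomial_mul_gaussian (P : ℝ[X]) (k : ℕ) :
    ∃ C : ℝ, ∀ x : ℝ, |x| ^ k * |P.eval x * Real.exp (-Real.pi * x ^ 2)| ≤ C := by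
  induction P using Polynomial.induction_on' with
  | add P Q hP hQ =>
    obtain ⟨C, hC⟩ := hP
    obtain ⟨D, hD⟩ := hQ
    refine ⟨C + D, fun x => le_trans ?_ (add_le_add (hC x) (hD x))⟩
    rw [Polynomial.eval_add, add_mul, ← mul_add]
    gcongr
    exact abs_add_le _ _
  | monomial n a =>
    -- The constant combines `|x|^m ≤ m! exp |x|` with `|x| - π x² ≤ 1`.
    refine ⟨|a| * ((k + n).factorial * Real.exp 1), fun x => ?_⟩
    have h1 : |x| ^ (k + n) ≤ (k + n).factorial * Real.exp |x| := by
      have := Real.pow_div_factorial_le_exp |x| (abs_nonneg x) (k + n)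
      rwa [div_le_iff₀' (by positivity)] at this
    have h2 : |x| + -Real.pi * x ^ 2 ≤ 1 := by
      have := Real.pi_gt_three
      nlinarith [sq_abs x, sq_nonneg (|x| - 1), sq_nonneg x]
    calc |x| ^ k * |(Polynomial.monomial n a).eval x * Real.exp (-Real.pi * x ^ 2)|
        = |a| * (|x| ^ (k + n) * Real.exp (-Real.pi * x ^ 2)) := by
          rw [Polynomial.eval_monomial, abs_mul, abs_mul, abs_pow, Real.abs_exp]; ring
      _ ≤ |a| * ((k + n).factorial * Real.exp |x| * Real.exp (-Real.pi * x ^ 2)) := by gcongr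
      _ = |a| * ((k + n).factorial * Real.exp (|x| + -Real.pi * x ^ 2)) := by
          rw [Real.exp_add]; ring
      _ ≤ _ := by gcongr

/-- The Gaussian `exp (-π x²)` as a real Schwartz function. -/
noncomputable def realGaussianSchwartz : 𝓢(ℝ, ℝ) where
  toFun x := Real.exp (-Real.pi * x ^ 2)
  smooth' := by fun_prop
  decay' k n := by
    obtain ⟨P, hP⟩ := exists_polynomial_iteratedDeriv_gaussian n
    obtain ⟨C, hC⟩ := exists_bound_pow_mul_polynomial_mul_gaussian P k
    refine ⟨C, fun x => ?_⟩
    rw [norm_iteratedFDeriv_eq_norm_iteratedDeriv, hP]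
    exact hC x

/-- The Gaussian `exp (-π x²)` as a complex Schwartz function. -/
noncomputable def gaussianSchwartz : 𝓢(ℝ, ℂ) :=
  realGaussianSchwartz.postcompCLM Complex.ofRealCLM

theorem gaussianSchwartz_apply (x : ℝ) :
    gaussianSchwartz x = (Real.exp (-Real.pi * x ^ 2) : ℝ) := rfl

/-! ### Derivatives of `exp (-2 π t²)` -/

/-- `H_k(t) = exp (π t²) (d/dt)^k exp (-2 π t²)`. -/
noncomputable def rawHermite (k : ℕ) (t : ℝ) : ℝ :=
  Real.exp (Real.pi * t ^ 2) * iteratedDeriv k (fun s : ℝ => Real.exp (-2 * Real.pi * s ^ 2)) t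

theorem hasDerivAt_iteratedDeriv_gaussian (k : ℕ) (t : ℝ) :
    HasDerivAt (iteratedDeriv k (fun s : ℝ => Real.exp (-2 * Real.pi * s ^ 2)))
      (iteratedDeriv (k + 1) (fun s : ℝ => Real.exp (-2 * Real.pi * s ^ 2)) t) t := by
  have hs : ContDiff ℝ (k + 1) (fun s : ℝ => Real.exp (-2 * Real.pi * s ^ 2)) := by fun_prop
  rw [iteratedDeriv_succ]
  exact ((hs.differentiable_iteratedDeriv k (by exact_mod_cast Nat.lt_succ_self k)) t).hasDerivAt

theorem hasDerivAt_rawHermite (k : ℕ) (t : ℝ) :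
    HasDerivAt (rawHermite k) (2 * Real.pi * t * rawHermite k t + rawHermite (k + 1) t) t := by
  convert! (hasDerivAt_exp_mul_sq Real.pi t).mul (hasDerivAt_iteratedDeriv_gaussian k t) using 1
  simp only [rawHermite]
  ring

theorem rawHermite_zero (t : ℝ) : rawHermite 0 t = Real.exp (-Real.pi * t ^ 2) := by
  rw [rawHermite, iteratedDeriv_zero, ← Real.exp_add]
  ring_nf

theorem iteratedDeriv_one_gaussian (t : ℝ) :
    iteratedDeriv 1 (fun s : ℝ => Real.exp (-2 * Real.pi * s ^ 2)) t =
      -4 * Real.pi * t * Real.exp (-2 * Real.pi * t ^ 2) := by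
  rw [iteratedDeriv_one, (hasDerivAt_exp_mul_sq (-2 * Real.pi) t).deriv]
  ring

/-- Repeated differentiation of the equation `y' = -4π t y`. -/
theorem iteratedDeriv_add_two_gaussian (k : ℕ) (t : ℝ) :
    iteratedDeriv (k + 2) (fun s : ℝ => Real.exp (-2 * Real.pi * s ^ 2)) t =
      -4 * Real.pi * t * iteratedDeriv (k + 1) (fun s : ℝ => Real.exp (-2 * Real.pi * s ^ 2)) t -
      4 * Real.pi * (k + 1) * iteratedDeriv k (fun s : ℝ => Real.exp (-2 * Real.pi * s ^ 2)) t := by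
  induction k generalizing t with
  | zero =>
    have h := (((hasDerivAt_id t).const_mul (-4 * Real.pi)).mul
      (hasDerivAt_iteratedDeriv_gaussian 0 t))
    have h' := hasDerivAt_iteratedDeriv_gaussian 1 t
    have he : iteratedDeriv 1 (fun s : ℝ => Real.exp (-2 * Real.pi * s ^ 2)) =
        (fun y => -4 * Real.pi * id y) *
          iteratedDeriv 0 (fun s : ℝ => Real.exp (-2 * Real.pi * s ^ 2)) := by
      ext s
      rw [iteratedDeriv_one_gaussian]
      simp
    rw [he] at h'
    have := h'.unique h
    rw [this]
    simp
    ring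
  | succ k ih =>
    have h := (((hasDerivAt_id t).const_mul (-4 * Real.pi)).mul
      (hasDerivAt_iteratedDeriv_gaussian (k + 1) t)).sub
      ((hasDerivAt_iteratedDeriv_gaussian k t).const_mul (4 * Real.pi * (k + 1)))
    have h' := hasDerivAt_iteratedDeriv_gaussian (k + 2) t
    rw [show iteratedDeriv (k + 2) (fun s : ℝ => Real.exp (-2 * Real.pi * s ^ 2)) = _ from
      funext ih] at h'
    have := h'.unique h
    rw [show k + 1 + 2 = k + 2 + 1 from rfl, this]
    push_cast
    simp
    ring

theorem rawHermite_one (t : ℝ) : rawHermite 1 t = -4 * Real.pi * t * rawHermite 0 t := by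
  rw [rawHermite, rawHermite, iteratedDeriv_one_gaussian, iteratedDeriv_zero]
  ring

theorem rawHermite_add_two (k : ℕ) (t : ℝ) :
    rawHermite (k + 2) t =
      -4 * Real.pi * t * rawHermite (k + 1) t - 4 * Real.pi * (k + 1) * rawHermite k t := by
  simp only [rawHermite, iteratedDeriv_add_two_gaussian]
  ring

/-! ### Hermite functions as Schwartz functions -/

/-- Multiplication by the variable on Schwartz functions. -/
noncomputable def mulX : 𝓢(ℝ, ℂ) →L[ℝ] 𝓢(ℝ, ℂ) :=
  SchwartzMap.smulLeftCLM ℂ (fun x : ℝ => x)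

theorem mulX_apply (f : 𝓢(ℝ, ℂ)) (x : ℝ) : mulX f x = x * f x := by
  rw [mulX, SchwartzMap.smulLeftCLM_apply_apply (by fun_prop), Complex.real_smul]

/-- The functions `rawHermite k` as Schwartz functions. -/
noncomputable def rawHermiteSchwartz : ℕ → 𝓢(ℝ, ℂ)
  | 0 => gaussianSchwartz
  | k + 1 => SchwartzMap.derivCLM ℝ ℂ (rawHermiteSchwartz k) -
      (2 * Real.pi) • mulX (rawHermiteSchwartz k)

theorem rawHermiteSchwartz_apply (k : ℕ) (x : ℝ) :
    rawHermiteSchwartz k x = (rawHermite k x : ℂ) := by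
  induction k generalizing x with
  | zero => rw [rawHermiteSchwartz, gaussianSchwartz_apply, rawHermite_zero]
  | succ k ih =>
    rw [rawHermiteSchwartz, sub_apply, smul_apply, mulX_apply,
      SchwartzMap.derivCLM_apply, show ⇑(rawHermiteSchwartz k) = _ from funext ih,
      (hasDerivAt_rawHermite k x).ofReal_comp.deriv]
    simp
    ring

theorem fourier_mulX_apply (f : 𝓢(ℝ, ℂ)) (x : ℝ) :
    𝓕 (mulX f) x = Complex.I / (2 * Real.pi) * deriv (𝓕 f : 𝓢(ℝ, ℂ)) x := by
  have hx : Integrable (fun x : ℝ => x • f x) := by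
    refine (mulX f).integrable.congr (Filter.Eventually.of_forall fun x => ?_)
    simp [mulX_apply]
  have h := congrFun (Real.deriv_fourier f.integrable hx) x
  have h2 : (fun x : ℝ => (-2 * Real.pi * Complex.I * x) • f x) =
      ⇑((-2 * Real.pi * Complex.I : ℂ) • mulX f) := by
    ext y
    simp [mulX_apply]
    ring
  rw [SchwartzMap.fourier_coe, SchwartzMap.fourier_coe, h, h2,
    ← SchwartzMap.fourier_coe, ← SchwartzMap.fourier_coe, FourierTransform.fourier_smul, smul_apply, smul_eq_mul, ← mul_assoc]
  have : (Real.pi : ℂ) ≠ 0 := by exact_mod_cast Real.pi_ne_zero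
  field_simp
  simp

theorem fourier_derivCLM_apply (f : 𝓢(ℝ, ℂ)) (x : ℝ) :
    𝓕 (SchwartzMap.derivCLM ℝ ℂ f) x = 2 * Real.pi * Complex.I * x * (𝓕 f : 𝓢(ℝ, ℂ)) x := by
  have h := congrFun (Real.fourier_deriv f.integrable f.differentiable
    (SchwartzMap.derivCLM ℝ ℂ f).integrable) x
  rw [SchwartzMap.fourier_coe, SchwartzMap.fourier_coe]
  exact h

/-- The raising operator `A = d/dx - 2πx` satisfies `𝓕 A = -i A 𝓕`, because `𝓕` exchanges its two
terms up to constants; the Gaussian is fixed by `𝓕`. -/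
theorem fourier_rawHermiteSchwartz (k : ℕ) :
    𝓕 (rawHermiteSchwartz k) = (-Complex.I) ^ k • rawHermiteSchwartz k := by
  induction k with
  | zero =>
    ext x
    have h := congrFun (fourier_gaussian_pi (b := 1) (by simp)) x
    have h2 : (fun x : ℝ => Complex.exp (-Real.pi * 1 * x ^ 2)) = ⇑(rawHermiteSchwartz 0) := by
      ext y
      simp [rawHermiteSchwartz, gaussianSchwartz_apply]
    rw [SchwartzMap.fourier_coe, ← h2, h, pow_zero, one_smul, ← h2]
    simp
  | succ k ih =>
    ext x
    have h : 𝓕 (rawHermiteSchwartz (k + 1)) = 𝓕 (SchwartzMap.derivCLM ℝ ℂ (rawHermiteSchwartz k)) -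
        (2 * Real.pi) • 𝓕 (mulX (rawHermiteSchwartz k)) := by
      rw [rawHermiteSchwartz, sub_eq_add_neg, FourierTransform.fourier_add, sub_eq_add_neg,
        ← neg_smul, ← neg_smul, FourierTransform.fourier_smul]
    have hd : deriv (⇑((-Complex.I) ^ k • rawHermiteSchwartz k)) x =
        (-Complex.I) ^ k * deriv (rawHermiteSchwartz k) x :=
      ((rawHermiteSchwartz k).hasDerivAt x).const_mul ((-Complex.I) ^ k) |>.deriv
    rw [h, sub_apply, smul_apply, fourier_mulX_apply, fourier_derivCLM_apply, ih, hd,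
      rawHermiteSchwartz]
    simp only [smul_apply, sub_apply, mulX_apply, SchwartzMap.derivCLM_apply, Complex.real_smul,
      smul_eq_mul]
    have : (Real.pi : ℂ) ≠ 0 := by exact_mod_cast Real.pi_ne_zero
    push_cast
    field_simp
    ring_nf

/-! ### Orthonormality -/

theorem deriv_rawHermiteSchwartz_zero (x : ℝ) :
    deriv (rawHermiteSchwartz 0) x + 2 * Real.pi * (x * rawHermiteSchwartz 0 x) = 0 := by
  rw [show ⇑(rawHermiteSchwartz 0) = _ from funext (rawHermiteSchwartz_apply 0),
    (hasDerivAt_rawHermite 0 x).ofReal_comp.deriv, rawHermite_one]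
  push_cast
  ring

/-- The lowering operator `d/dx + 2πx`; by the three-term recurrence it steps down one level. -/
theorem deriv_rawHermiteSchwartz_succ (k : ℕ) (x : ℝ) :
    deriv (rawHermiteSchwartz (k + 1)) x + 2 * Real.pi * (x * rawHermiteSchwartz (k + 1) x) =
      -(4 * Real.pi * (k + 1)) * rawHermiteSchwartz k x := by
  rw [rawHermiteSchwartz_apply k x,
    show ⇑(rawHermiteSchwartz (k + 1)) = _ from funext (rawHermiteSchwartz_apply (k + 1)),
    (hasDerivAt_rawHermite (k + 1) x).ofReal_comp.deriv, rawHermite_add_two]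
  push_cast
  ring

theorem integrable_schwartz_mul (f g : 𝓢(ℝ, ℂ)) : Integrable (fun x => f x * g x) :=
  (SchwartzMap.pairing (ContinuousLinearMap.mul ℝ ℂ) f g).integrable

/-- Integration by parts: the transpose of the raising operator is minus the lowering operator. -/
theorem integral_rawHermiteSchwartz_succ_mul (j k : ℕ) :
    ∫ x, rawHermiteSchwartz (j + 1) x * rawHermiteSchwartz k x =
      -∫ x, rawHermiteSchwartz j x *
        (deriv (rawHermiteSchwartz k) x + 2 * Real.pi * (x * rawHermiteSchwartz k x)) := by
  have h1 := integrable_schwartz_mul (SchwartzMap.derivCLM ℝ ℂ (rawHermiteSchwartz j))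
    (rawHermiteSchwartz k)
  have h2 := integrable_schwartz_mul (rawHermiteSchwartz j)
    (SchwartzMap.derivCLM ℝ ℂ (rawHermiteSchwartz k))
  have h3 := (integrable_schwartz_mul (rawHermiteSchwartz j)
    (mulX (rawHermiteSchwartz k))).const_mul (2 * Real.pi : ℂ)
  simp only [SchwartzMap.derivCLM_apply, mulX_apply] at h1 h2 h3
  have e1 : ∀ x, rawHermiteSchwartz (j + 1) x * rawHermiteSchwartz k x =
      deriv (rawHermiteSchwartz j) x * rawHermiteSchwartz k x -
        2 * Real.pi * (rawHermiteSchwartz j x * (x * rawHermiteSchwartz k x)) := fun x => by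
    rw [rawHermiteSchwartz, sub_apply, smul_apply, mulX_apply, SchwartzMap.derivCLM_apply,
      Complex.real_smul]
    push_cast
    ring
  have e2 : ∀ x, rawHermiteSchwartz j x *
        (deriv (rawHermiteSchwartz k) x + 2 * Real.pi * (x * rawHermiteSchwartz k x)) =
      rawHermiteSchwartz j x * deriv (rawHermiteSchwartz k) x +
        2 * Real.pi * (rawHermiteSchwartz j x * (x * rawHermiteSchwartz k x)) := fun x => by ring
  simp_rw [e1, e2]
  rw [integral_sub h1 h3, integral_add h2 h3,
    SchwartzMap.integral_mul_deriv_eq_neg_deriv_mul]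
  ring

theorem integral_rawHermiteSchwartz_zero_sq :
    ∫ x, rawHermiteSchwartz 0 x * rawHermiteSchwartz 0 x = (1 / √2 : ℝ) := by
  have h : ∀ x : ℝ, rawHermiteSchwartz 0 x * rawHermiteSchwartz 0 x =
      (Real.exp (-(2 * Real.pi) * x ^ 2) : ℝ) := fun x => by
    rw [rawHermiteSchwartz_apply, rawHermite_zero, ← Complex.ofReal_mul, ← Real.exp_add]
    ring_nf
  simp_rw [h]
  rw [integral_complex_ofReal, integral_gaussian]
  congr 1
  rw [show Real.pi / (2 * Real.pi) = 1 / 2 by field_simp]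
  simp

theorem integral_rawHermiteSchwartz_mul (j k : ℕ) :
    ∫ x, rawHermiteSchwartz j x * rawHermiteSchwartz k x =
      if j = k then (((4 * Real.pi) ^ k * k.factorial / √2 : ℝ) : ℂ) else 0 := by
  have hz : ∀ j, ∫ x, rawHermiteSchwartz (j + 1) x * rawHermiteSchwartz 0 x = 0 := fun j => by
    rw [integral_rawHermiteSchwartz_succ_mul]
    simp_rw [deriv_rawHermiteSchwartz_zero]
    simp
  induction j generalizing k with
  | zero =>
    cases k with
    | zero => rw [integral_rawHermiteSchwartz_zero_sq]; simp
    | succ k =>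
      simp_rw [mul_comm (rawHermiteSchwartz 0 _)]
      rw [hz]
      simp
  | succ j ih =>
    cases k with
    | zero => rw [hz]; simp
    | succ k =>
      rw [integral_rawHermiteSchwartz_succ_mul]
      simp_rw [deriv_rawHermiteSchwartz_succ, mul_left_comm (rawHermiteSchwartz j _)]
      rw [integral_const_mul, ih]
      by_cases h : j = k
      · subst h
        simp only [if_true]
        push_cast [Nat.factorial_succ]
        ring
      · simp [h]

/-- The normalizing constant of the Hermite functions. -/
noncomputable def hermiteConst (k : ℕ) : ℝ :=
  (2 : ℝ) ^ (1 / 4 : ℝ) / √(k.factorial : ℝ) * (-1 / (2 * √Real.pi)) ^ k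

theorem hermiteConst_sq (k : ℕ) :
    hermiteConst k * hermiteConst k * ((4 * Real.pi) ^ k * k.factorial / √2) = 1 := by
  have h1 : (2 : ℝ) ^ (1 / 4 : ℝ) * (2 : ℝ) ^ (1 / 4 : ℝ) = √2 := by
    rw [← Real.rpow_add (by norm_num), Real.sqrt_eq_rpow]
    norm_num
  have h2 : √(k.factorial : ℝ) * √(k.factorial : ℝ) = k.factorial :=
    Real.mul_self_sqrt (by positivity)
  have h3 : (-1 / (2 * √Real.pi)) ^ k * (-1 / (2 * √Real.pi)) ^ k * (4 * Real.pi) ^ k = 1 := by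
    rw [← mul_pow, ← mul_pow]
    have : -1 / (2 * √Real.pi) * (-1 / (2 * √Real.pi)) * (4 * Real.pi) = 1 := by
      have hp : √Real.pi * √Real.pi = Real.pi := Real.mul_self_sqrt Real.pi_pos.le
      have : √Real.pi ≠ 0 := by positivity
      field_simp
      nlinarith
    rw [this, one_pow]
  have h4 : (k.factorial : ℝ) ≠ 0 := by positivity
  have h5 : √2 ≠ 0 := by positivity
  calc hermiteConst k * hermiteConst k * ((4 * Real.pi) ^ k * k.factorial / √2)
      = ((2 : ℝ) ^ (1 / 4 : ℝ) * (2 : ℝ) ^ (1 / 4 : ℝ)) /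
          (√(k.factorial : ℝ) * √(k.factorial : ℝ)) *
          ((-1 / (2 * √Real.pi)) ^ k * (-1 / (2 * √Real.pi)) ^ k * (4 * Real.pi) ^ k) *
          (k.factorial / √2) := by rw [hermiteConst]; ring
    _ = 1 := by
      rw [h1, h2, h3]
      field_simp

theorem hermiteConst_succ (k : ℕ) :
    2 * √Real.pi * (√(k + 1 : ℝ) * hermiteConst (k + 1)) = -hermiteConst k := by
  have hp : √Real.pi ≠ 0 := by positivity
  have hk : √(k + 1 : ℝ) ≠ 0 := by positivity
  have hf : √(k.factorial : ℝ) ≠ 0 := by positivity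
  rw [hermiteConst, hermiteConst, Nat.factorial_succ, pow_succ]
  push_cast
  rw [Real.sqrt_mul (by positivity)]
  field_simp

/-- The normalized Hermite functions as Schwartz functions. -/
noncomputable def hermiteSchwartz (k : ℕ) : 𝓢(ℝ, ℂ) :=
  (hermiteConst k : ℂ) • rawHermiteSchwartz k

theorem hermiteSchwartz_apply (k : ℕ) (x : ℝ) :
    hermiteSchwartz k x = (hermiteFunction k x : ℂ) := by
  rw [hermiteSchwartz, smul_apply, rawHermiteSchwartz_apply, hermiteFunction, rawHermite,
    hermiteConst, smul_eq_mul, ← Complex.ofReal_mul, mul_assoc _ (Real.exp _)]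

theorem fourier_hermiteSchwartz (k : ℕ) :
    𝓕 (hermiteSchwartz k) = (-Complex.I) ^ k • hermiteSchwartz k := by
  rw [hermiteSchwartz, FourierTransform.fourier_smul, fourier_rawHermiteSchwartz, smul_comm]

/-- The normalized three-term recurrence; the alternating sign in `hermiteConst` makes both
coefficients nonnegative. At `k = 0` the truncated index `k - 1` is harmless since `√0 = 0`. -/
theorem mulX_hermiteSchwartz (k : ℕ) :
    (2 * √Real.pi) • mulX (hermiteSchwartz k) =
      √(k + 1 : ℝ) • hermiteSchwartz (k + 1) + √(k : ℝ) • hermiteSchwartz (k - 1) := by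
  have hp : √Real.pi * √Real.pi = Real.pi := Real.mul_self_sqrt Real.pi_pos.le
  ext x
  simp only [add_apply, smul_apply, mulX_apply, hermiteSchwartz, smul_eq_mul, Complex.real_smul,
    rawHermiteSchwartz_apply]
  norm_cast
  have h1 := hermiteConst_succ k
  cases k with
  | zero =>
    rw [rawHermite_one]
    simp at h1 ⊢
    rw [← neg_eq_iff_eq_neg] at h1
    rw [← h1]
    linear_combination (-4 * x * rawHermite 0 x * hermiteConst 1) * hp
  | succ k =>
    have h2 := hermiteConst_succ k
    have hk : √(k + 1 : ℝ) * √(k + 1 : ℝ) = k + 1 := Real.mul_self_sqrt (by positivity)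
    have h1' : hermiteConst (k + 1) = -(2 * √Real.pi * (√((k : ℝ) + 2) * hermiteConst (k + 2))) := by
      push_cast at h1
      rw [show (k : ℝ) + 1 + 1 = k + 2 by ring] at h1
      linarith
    have h2' : hermiteConst k = -(2 * √Real.pi * (√((k : ℝ) + 1) * hermiteConst (k + 1))) := by
      linarith
    rw [show k + 1 + 1 = k + 2 from rfl, rawHermite_add_two, show k + 1 - 1 = k from rfl]
    push_cast
    rw [h2', h1']
    linear_combination (-4 * x * rawHermite (k + 1) x * √((k : ℝ) + 2) * hermiteConst (k + 2)) * hp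
      - 4 * √((k : ℝ) + 2) * rawHermite k x * hermiteConst (k + 2) * (√Real.pi * √Real.pi * hk + (k + 1) * hp)

/-- The Hermite functions as elements of `L²(ℝ)`. -/
noncomputable def hermiteL2 (k : ℕ) : L2R := (hermiteSchwartz k).toLp 2

theorem hermiteL2_ae (k : ℕ) : ∀ᵐ t : ℝ, hermiteL2 k t = (hermiteFunction k t : ℂ) := by
  filter_upwards [(hermiteSchwartz k).coeFn_toLp 2] with t ht
  rw [hermiteL2, ht, hermiteSchwartz_apply]

theorem orthonormal_hermiteL2 : Orthonormal ℂ hermiteL2 := by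
  rw [orthonormal_iff_ite]
  intro j k
  have h : ∀ x, inner ℂ (hermiteSchwartz j x) (hermiteSchwartz k x) =
      (hermiteConst j * hermiteConst k : ℂ) *
        (rawHermiteSchwartz j x * rawHermiteSchwartz k x) := fun x => by
    simp only [hermiteSchwartz, smul_apply, rawHermiteSchwartz_apply, smul_eq_mul,
      RCLike.inner_apply, map_mul, Complex.conj_ofReal]
    ring
  rw [hermiteL2, hermiteL2, SchwartzMap.inner_toL2_toL2_eq _ _ volume]
  simp_rw [h]
  rw [integral_const_mul, integral_rawHermiteSchwartz_mul]
  by_cases hjk : j = k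
  · subst hjk
    simp only [if_true]
    exact_mod_cast hermiteConst_sq j
  · simp [hjk]

theorem fourier_hermiteL2 (k : ℕ) : 𝓕 (hermiteL2 k) = (-Complex.I) ^ k • hermiteL2 k := by
  rw [hermiteL2, SchwartzMap.toLp_fourier_eq, fourier_hermiteSchwartz]
  exact (SchwartzMap.toLpCLM ℂ ℂ 2 volume).map_smul _ _

/-! ### Completeness -/

theorem ae_eq_zero_of_fourier_eq_zero {g : ℝ → ℂ} (hg : Integrable g) (h : ∀ s, 𝓕 g s = 0) :
    ∀ᵐ x, g x = 0 := by
  refine ae_eq_zero_of_integral_contDiff_smul_eq_zero hg.locallyIntegrable fun φ hφ hφc => ?_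
  have hc : HasCompactSupport (fun x => (φ x : ℂ)) := hφc.comp_left Complex.ofReal_zero
  have hd : ContDiff ℝ ((⊤ : ℕ∞) : WithTop ℕ∞) (fun x => (φ x : ℂ)) :=
    Complex.ofRealCLM.contDiff.comp hφ
  -- Writing the test function as `φ = 𝓕 ψ` moves the transform onto `g`: `∫ g φ = ∫ (𝓕 g) ψ = 0`.
  set ψ : 𝓢(ℝ, ℂ) := 𝓕⁻ (hc.toSchwartzMap hd) with hψ
  have key := VectorFourier.integral_fourierIntegral_smul_eq_flip (L := innerₗ ℝ)
    (μ := volume) (ν := volume) Real.continuous_fourierChar continuous_inner hg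
    (ψ.integrable (μ := volume))
  have h1 : ∀ s, VectorFourier.fourierIntegral Real.fourierChar volume (innerₗ ℝ) g s = 0 := h
  have h2 : ∀ x, VectorFourier.fourierIntegral Real.fourierChar volume (innerₗ ℝ).flip ψ x =
      φ x := fun x => by
    have : 𝓕 ψ = hc.toSchwartzMap hd := by
      rw [hψ, FourierTransform.fourier_fourierInv_eq]
    have h3 := DFunLike.congr_fun this x
    rw [SchwartzMap.fourier_coe] at h3
    rw [flip_innerₗ]
    exact h3
  simp_rw [h1, h2] at key
  simp only [zero_smul, integral_zero] at key
  rw [key]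
  refine integral_congr_ae (Filter.Eventually.of_forall fun x => ?_)
  simp [mul_comm]

theorem hasSum_pow_div_factorial_real (x : ℝ) :
    HasSum (fun n : ℕ => x ^ n / n.factorial) (Real.exp x) := by
  rw [Real.exp_eq_exp_ℝ]
  exact NormedSpace.expSeries_div_hasSum_exp x

theorem hasSum_pow_div_factorial_complex (z : ℂ) :
    HasSum (fun n : ℕ => z ^ n / n.factorial) (Complex.exp z) := by
  rw [Complex.exp_eq_exp_ℂ]
  exact NormedSpace.expSeries_div_hasSum_exp z

/-- Expanding `exp (-2πi t s)` in powers of `t` writes the Fourier transform of `exp (-π t²) f` as a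
series of the given moments, hence it vanishes. Gaussian decay justifies the interchange of sum and
integral. -/
theorem ae_eq_zero_of_forall_moment_eq_zero {f : ℝ → ℂ} (hf : MemLp f 2)
    (h : ∀ n : ℕ, ∫ t : ℝ, (t : ℂ) ^ n * Real.exp (-Real.pi * t ^ 2) * f t = 0) :
    ∀ᵐ t, f t = 0 := by
  have hexp : ∀ s : ℝ, Integrable
      (fun t => ‖f t‖ * (Real.exp (-Real.pi * t ^ 2) * Real.exp (2 * Real.pi * |s| * |t|))) := by
    intro s
    refine hf.norm.integrable_mul (q := 2) ?_
    -- From `(2|s| - |t|)² ≥ 0`: `-π t² + 2π |s| |t| ≤ 2π s² - (π/2) t²`.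
    have hb : MemLp (fun t : ℝ => Real.exp (2 * Real.pi * s ^ 2) *
        Real.exp (-(Real.pi / 2) * t ^ 2)) 2 := by
      refine MemLp.const_mul ?_ _
      rw [memLp_two_iff_integrable_sq (by fun_prop)]
      refine (integrable_exp_neg_mul_sq Real.pi_pos).congr (Filter.Eventually.of_forall fun t => ?_)
      simp only
      rw [← Real.exp_nat_mul]
      push_cast
      ring_nf
    refine hb.mono (by fun_prop) (Filter.Eventually.of_forall fun t => ?_)
    rw [← Real.exp_add, ← Real.exp_add, Real.norm_of_nonneg (Real.exp_nonneg _),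
      Real.norm_of_nonneg (Real.exp_nonneg _), Real.exp_le_exp]
    have := mul_nonneg Real.pi_pos.le (sq_nonneg (2 * |s| - |t|))
    rw [sub_sq, mul_pow, sq_abs, sq_abs] at this
    nlinarith
  have hmeas : AEStronglyMeasurable (fun t : ℝ => (Real.exp (-Real.pi * t ^ 2) : ℂ) * f t) :=
    (by fun_prop : Continuous fun t : ℝ => (Real.exp (-Real.pi * t ^ 2) : ℂ)).aestronglyMeasurable.mul
      hf.1
  have hint : Integrable (fun t : ℝ => (Real.exp (-Real.pi * t ^ 2) : ℂ) * f t) := by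
    refine (hexp 0).mono hmeas (Filter.Eventually.of_forall fun t => ?_)
    rw [norm_mul, Complex.norm_real, Real.norm_of_nonneg (Real.exp_nonneg _)]
    refine le_of_eq_of_le ?_ (le_abs_self _)
    simp [mul_comm]
  have hz := ae_eq_zero_of_fourier_eq_zero hint fun s => by
    rw [Real.fourier_real_eq_integral_exp_smul]
    have hs := hasSum_integral_of_dominated_convergence (μ := (volume : Measure ℝ))
      (F := fun (n : ℕ) (t : ℝ) => ((↑(-2 * Real.pi * t * s) * Complex.I) ^ n / n.factorial : ℂ) *
        ((Real.exp (-Real.pi * t ^ 2) : ℂ) * f t))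
      (f := fun t => Complex.exp (↑(-2 * Real.pi * t * s) * Complex.I) •
        ((Real.exp (-Real.pi * t ^ 2) : ℂ) * f t))
      (bound := fun n t => (2 * Real.pi * |s| * |t|) ^ n / n.factorial *
        (‖f t‖ * Real.exp (-Real.pi * t ^ 2)))
      (fun n => (by fun_prop : Continuous fun t : ℝ =>
        ((↑(-2 * Real.pi * t * s) * Complex.I) ^ n / n.factorial : ℂ)).aestronglyMeasurable.mul
          hmeas)
      (fun n => Filter.Eventually.of_forall fun t => le_of_eq (by
        rw [norm_mul, norm_mul, norm_div, norm_pow, norm_mul, Complex.norm_real, Complex.norm_real,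
          Complex.norm_I, Complex.norm_natCast, Real.norm_of_nonneg (Real.exp_nonneg _),
          Real.norm_eq_abs, abs_mul, abs_mul, abs_mul, abs_neg, abs_two, abs_of_pos Real.pi_pos]
        ring))
      (Filter.Eventually.of_forall fun t => (Real.summable_pow_div_factorial _).mul_right _)
      (by
        refine (hexp s).congr (Filter.Eventually.of_forall fun t => ?_)
        simp only
        rw [tsum_mul_right, (hasSum_pow_div_factorial_real _).tsum_eq]
        ring)
      (Filter.Eventually.of_forall fun t => (hasSum_pow_div_factorial_complex _).mul_right _)
    refine hs.unique ?_
    convert! hasSum_zero using 2 with n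
    have : ∀ t : ℝ, ((↑(-2 * Real.pi * t * s) * Complex.I) ^ n / n.factorial : ℂ) *
        ((Real.exp (-Real.pi * t ^ 2) : ℂ) * f t) =
        ((-2 * Real.pi * s * Complex.I) ^ n / n.factorial : ℂ) *
          ((t : ℂ) ^ n * Real.exp (-Real.pi * t ^ 2) * f t) := fun t => by
      push_cast
      rw [show (-2 * Real.pi * t * s * Complex.I : ℂ) = (-2 * Real.pi * s * Complex.I) * t by ring,
        mul_pow]
      ring
    simp_rw [this]
    rw [integral_const_mul, h, mul_zero]
  filter_upwards [hz] with t ht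
  exact (mul_eq_zero.1 ht).resolve_left (by exact_mod_cast (Real.exp_pos _).ne')

/-- By the recurrence, `t^n h_k` is a combination of Hermite functions. The induction on `n` needs
all `k` at once. -/
theorem inner_mulX_pow_hermiteSchwartz_eq_zero {f : L2R}
    (h : ∀ k, inner ℂ f (hermiteL2 k) = 0) (n k : ℕ) :
    inner ℂ f (((mulX ^ n) (hermiteSchwartz k)).toLp 2) = 0 := by
  let Λ : 𝓢(ℝ, ℂ) →L[ℝ] ℂ :=
    ((innerSL ℂ f).restrictScalars ℝ).comp (SchwartzMap.toLpCLM ℝ ℂ 2 volume)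
  change Λ ((mulX ^ n) (hermiteSchwartz k)) = 0
  induction n generalizing k with
  | zero => exact h k
  | succ n ih =>
    have h1 := congrArg (fun u => Λ ((mulX ^ n) u)) (mulX_hermiteSchwartz k)
    simp only [map_smul, map_add, ih, smul_zero, add_zero] at h1
    rw [pow_succ]
    exact (smul_eq_zero.1 h1).resolve_left (by positivity)

theorem mulX_pow_apply (n : ℕ) (f : 𝓢(ℝ, ℂ)) (x : ℝ) : (mulX ^ n) f x = (x : ℂ) ^ n * f x := by
  induction n with
  | zero => simp
  | succ n ih =>
    rw [pow_succ', show (mulX * mulX ^ n) f = mulX ((mulX ^ n) f) from rfl, mulX_apply, ih]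
    ring

theorem inner_toLp_schwartz (f : L2R) (u : 𝓢(ℝ, ℂ)) :
    inner ℂ f (u.toLp 2) = ∫ t, u t * starRingEnd ℂ (f t) := by
  rw [L2.inner_def]
  refine integral_congr_ae ?_
  filter_upwards [u.coeFn_toLp 2] with t ht
  rw [ht, RCLike.inner_apply]

theorem eq_zero_of_forall_inner_hermiteL2_eq_zero {f : L2R}
    (h : ∀ k, inner ℂ f (hermiteL2 k) = 0) : f = 0 := by
  have hm : MemLp (fun t => starRingEnd ℂ (f t)) 2 := (Lp.memLp f).star
  have hC : (hermiteConst 0 : ℂ) ≠ 0 := by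
    have := hermiteConst_sq 0
    intro h0
    rw [Complex.ofReal_eq_zero.1 h0] at this
    simp at this
  have hz := ae_eq_zero_of_forall_moment_eq_zero hm fun n => by
    have h1 := inner_mulX_pow_hermiteSchwartz_eq_zero h n 0
    rw [inner_toLp_schwartz] at h1
    have : ∀ t : ℝ, (mulX ^ n) (hermiteSchwartz 0) t * starRingEnd ℂ (f t) = hermiteConst 0 *
        ((t : ℂ) ^ n * Real.exp (-Real.pi * t ^ 2) * starRingEnd ℂ (f t)) := fun t => by
      rw [mulX_pow_apply, hermiteSchwartz, smul_apply, rawHermiteSchwartz_apply, rawHermite_zero,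
        smul_eq_mul]
      ring
    simp_rw [this] at h1
    rw [integral_const_mul] at h1
    exact (mul_eq_zero.1 h1).resolve_left hC
  rw [Lp.eq_zero_iff_ae_eq_zero]
  filter_upwards [hz] with t ht
  simpa using ht

/-- The Hermite functions as a Hilbert basis of `L²(ℝ)`. -/
noncomputable def hermiteBasis : HilbertBasis ℕ ℂ L2R :=
  HilbertBasis.mkOfOrthogonalEqBot orthonormal_hermiteL2 (by
    rw [eq_bot_iff]
    intro f hf
    refine (Submodule.mem_bot ℂ).2 (eq_zero_of_forall_inner_hermiteL2_eq_zero fun k => ?_)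
    exact (Submodule.mem_orthogonal' _ f).1 hf _ (Submodule.subset_span ⟨k, rfl⟩))

theorem hermiteBasis_apply (k : ℕ) : hermiteBasis k = hermiteL2 k := by
  rw [hermiteBasis, HilbertBasis.coe_mkOfOrthogonalEqBot]

theorem hasSum_sq_norm_inner_hermiteL2 (f : L2R) :
    HasSum (fun k => ‖inner ℂ (hermiteL2 k) f‖ ^ 2) (‖f‖ ^ 2) := by
  have h := hermiteBasis.hasSum_inner_mul_inner f f
  have h2 := Complex.hasSum_re h
  convert! h2 using 2 with k
  · rw [← inner_conj_symm f, hermiteBasis_apply, Complex.conj_mul']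
    norm_cast
  · rw [inner_self_eq_norm_sq_to_K]
    norm_cast

/-! ### Second moments -/

theorem L2R.integrable_sq_norm (f : L2R) : Integrable (fun t => ‖f t‖ ^ 2) :=
  (memLp_two_iff_integrable_sq_norm (Lp.memLp f).1).1 (Lp.memLp f)

theorem L2R.integral_sq_norm (f : L2R) : ∫ t, ‖f t‖ ^ 2 = ‖f‖ ^ 2 := by
  have h := L2.inner_def (𝕜 := ℂ) f f
  simp_rw [inner_self_eq_norm_sq_to_K] at h
  have h2 : ((‖f‖ ^ 2 : ℝ) : ℂ) = ∫ t, ((‖f t‖ ^ 2 : ℝ) : ℂ) := by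
    rw [Complex.ofReal_pow]
    simp_rw [Complex.ofReal_pow]
    exact h
  rw [integral_complex_ofReal] at h2
  exact (Complex.ofReal_injective h2).symm

theorem L2R.integrable_sq_mul_sq_norm {f : L2R} (h : L2R.variance f ≠ ∞) :
    Integrable (fun t : ℝ => t ^ 2 * ‖f t‖ ^ 2) := by
  have hm : AEStronglyMeasurable (fun t => ‖f t‖) := (Lp.memLp f).1.norm
  have hv : Integrable (fun t : ℝ => |t - L2R.mean f| ^ 2 * ‖f t‖ ^ 2) := by
    refine ⟨(by fun_prop : Continuous fun t : ℝ =>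
      |t - L2R.mean f| ^ 2).aestronglyMeasurable.mul (hm.pow 2), ?_⟩
    rw [hasFiniteIntegral_iff_ofReal (Filter.Eventually.of_forall fun t => by positivity)]
    exact h.lt_top
  have hb := (hv.const_mul 2).add ((L2R.integrable_sq_norm f).const_mul (2 * L2R.mean f ^ 2))
  refine hb.mono' ((by fun_prop : Continuous fun t : ℝ => t ^ 2).aestronglyMeasurable.mul
    (hm.pow 2)) (Filter.Eventually.of_forall fun t => ?_)
  rw [Real.norm_of_nonneg (by positivity), Pi.add_apply, sq_abs]
  -- This is `t² ≤ 2 (t - μ)² + 2 μ²`, valid for any real `μ`, so a default value of the mean does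
  -- no harm.
  nlinarith [mul_nonneg (sq_nonneg (t - 2 * L2R.mean f)) (sq_nonneg ‖f t‖)]

theorem L2R.variance_add_sq_mean {f : L2R} (hf : ‖f‖ = 1) (h : L2R.variance f ≠ ∞) :
    L2R.variance f + ENNReal.ofReal (|L2R.mean f| ^ 2) =
      ENNReal.ofReal (∫ t : ℝ, t ^ 2 * ‖f t‖ ^ 2) := by
  have hm : AEStronglyMeasurable (fun t => ‖f t‖) := (Lp.memLp f).1.norm
  have h0 := L2R.integrable_sq_norm f
  have h2 := L2R.integrable_sq_mul_sq_norm h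
  have h1 : Integrable (fun t : ℝ => t * ‖f t‖ ^ 2) := by
    refine (h0.add h2).mono' (continuous_id.aestronglyMeasurable.mul (hm.pow 2))
      (Filter.Eventually.of_forall fun t => ?_)
    rw [norm_mul, Real.norm_of_nonneg (sq_nonneg ‖f t‖), Real.norm_eq_abs, Pi.add_apply]
    have : |t| ≤ 1 + t ^ 2 := by nlinarith [sq_abs t, sq_nonneg (|t| - 1)]
    nlinarith [sq_nonneg ‖f t‖]
  have hmean : ∫ t : ℝ, t * ‖f t‖ ^ 2 = L2R.mean f := by simp [L2R.mean, hf]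
  have he : ∀ t : ℝ, |t - L2R.mean f| ^ 2 * ‖f t‖ ^ 2 = t ^ 2 * ‖f t‖ ^ 2 -
      2 * L2R.mean f * (t * ‖f t‖ ^ 2) + L2R.mean f ^ 2 * ‖f t‖ ^ 2 := fun t => by
    rw [sq_abs]
    ring
  have hi : Integrable (fun t : ℝ => |t - L2R.mean f| ^ 2 * ‖f t‖ ^ 2) := by
    simp_rw [he]
    exact (h2.sub (h1.const_mul _)).add (h0.const_mul _)
  have hv : L2R.variance f = ENNReal.ofReal (∫ t : ℝ, |t - L2R.mean f| ^ 2 * ‖f t‖ ^ 2) :=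
    (ofReal_integral_eq_lintegral_ofReal hi
      (Filter.Eventually.of_forall fun t => by positivity)).symm
  have hs : ∫ t : ℝ, |t - L2R.mean f| ^ 2 * ‖f t‖ ^ 2 =
      (∫ t : ℝ, t ^ 2 * ‖f t‖ ^ 2) - L2R.mean f ^ 2 := by
    simp_rw [he]
    have h3 : Integrable (fun t : ℝ => t ^ 2 * ‖f t‖ ^ 2 - 2 * L2R.mean f * (t * ‖f t‖ ^ 2)) :=
      h2.sub (h1.const_mul _)
    rw [integral_add h3 (h0.const_mul _), integral_sub h2 (h1.const_mul _),
      integral_const_mul, integral_const_mul, hmean, L2R.integral_sq_norm, hf]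
    ring
  rw [hv, ← ENNReal.ofReal_add (integral_nonneg fun t => by positivity) (by positivity), hs, sq_abs]
  congr 1
  ring

/-! ### Hermite coefficients of second moments -/

theorem inner_hermiteL2_fourier (k : ℕ) (f : L2R) :
    inner ℂ (hermiteL2 k) (𝓕 f) = (-Complex.I) ^ k * inner ℂ (hermiteL2 k) f := by
  have h : inner ℂ (hermiteL2 k) f = Complex.I ^ k * inner ℂ (hermiteL2 k) (𝓕 f) := by
    rw [← Lp.inner_fourier_eq, fourier_hermiteL2, inner_smul_left]
    simp
  rw [h, ← mul_assoc, ← mul_pow]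
  simp

/-- Parseval for `2√π t f(t)`: multiplication by `t` is symmetric, so it moves onto `h_k`, where the
recurrence applies. -/
theorem hasSum_sq_norm_mulX_coeff {f : L2R}
    (h : Integrable (fun t : ℝ => t ^ 2 * ‖f t‖ ^ 2)) :
    HasSum (fun k : ℕ => ‖(√(k + 1 : ℝ) : ℂ) * inner ℂ (hermiteL2 (k + 1)) f +
      (√(k : ℝ) : ℂ) * inner ℂ (hermiteL2 (k - 1)) f‖ ^ 2)
      (4 * Real.pi * ∫ t : ℝ, t ^ 2 * ‖f t‖ ^ 2) := by
  have hm : AEStronglyMeasurable (fun t : ℝ => (t : ℂ) * f t) :=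
    Complex.continuous_ofReal.aestronglyMeasurable.mul (Lp.memLp f).1
  have hL : MemLp (fun t : ℝ => (t : ℂ) * f t) 2 := by
    rw [memLp_two_iff_integrable_sq_norm hm]
    refine h.congr (Filter.Eventually.of_forall fun t => ?_)
    simp [mul_pow]
  have hn : ‖hL.toLp‖ ^ 2 = ∫ t : ℝ, t ^ 2 * ‖f t‖ ^ 2 := by
    rw [← L2R.integral_sq_norm]
    refine integral_congr_ae ?_
    filter_upwards [hL.coeFn_toLp] with t ht
    rw [ht]
    simp [mul_pow]
  have hX : ∀ k, inner ℂ (hermiteL2 k) hL.toLp =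
      inner ℂ ((mulX (hermiteSchwartz k)).toLp 2) f := fun k => by
    rw [L2.inner_def, L2.inner_def]
    refine integral_congr_ae ?_
    filter_upwards [hL.coeFn_toLp, (hermiteSchwartz k).coeFn_toLp 2,
      (mulX (hermiteSchwartz k)).coeFn_toLp 2] with t h1 h2 h3
    rw [h1, hermiteL2, h2, h3, mulX_apply]
    simp only [RCLike.inner_apply, map_mul, Complex.conj_ofReal]
    ring
  have hc : ∀ k : ℕ, (2 * √Real.pi : ℂ) * inner ℂ (hermiteL2 k) hL.toLp =
      (√(k + 1 : ℝ) : ℂ) * inner ℂ (hermiteL2 (k + 1)) f +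
      (√(k : ℝ) : ℂ) * inner ℂ (hermiteL2 (k - 1)) f := fun k => by
    have h1 := congrArg (fun u => inner ℂ (SchwartzMap.toLpCLM ℝ ℂ 2 volume u) f)
      (mulX_hermiteSchwartz k)
    simp only [map_smul, map_add, inner_add_left, SchwartzMap.toLpCLM_apply] at h1
    simp only [RCLike.real_smul_eq_coe_smul (K := ℂ), inner_smul_left, RCLike.conj_ofReal] at h1
    rw [hX]
    push_cast at h1
    exact h1
  have hs := (hasSum_sq_norm_inner_hermiteL2 hL.toLp).mul_left (4 * Real.pi)
  rw [hn] at hs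
  convert! hs using 2 with k
  rw [← hc, norm_mul, mul_pow]
  congr 1
  rw [norm_mul, Complex.norm_real, Real.norm_of_nonneg (Real.sqrt_nonneg _), mul_pow,
    Real.sq_sqrt Real.pi_pos.le]
  norm_num

/-- Since `(-i)² = -1`, the two terms have the opposite relative sign in the second norm; the
parallelogram law removes the cross terms. -/
theorem sq_norm_add_sq_norm_coeff (a : ℕ → ℂ) (k : ℕ) :
    ‖(√(k + 1 : ℝ) : ℂ) * a (k + 1) + (√(k : ℝ) : ℂ) * a (k - 1)‖ ^ 2 +
      ‖(√(k + 1 : ℝ) : ℂ) * ((-Complex.I) ^ (k + 1) * a (k + 1)) +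
        (√(k : ℝ) : ℂ) * ((-Complex.I) ^ (k - 1) * a (k - 1))‖ ^ 2 =
    2 * ((k + 1) * ‖a (k + 1)‖ ^ 2 + k * ‖a (k - 1)‖ ^ 2) := by
  have hnorm : ∀ (x : ℝ) (z : ℂ), 0 ≤ x → ‖(√x : ℂ) * z‖ ^ 2 = x * ‖z‖ ^ 2 := fun x z hx => by
    rw [norm_mul, mul_pow, Complex.norm_real, Real.norm_of_nonneg (Real.sqrt_nonneg _),
      Real.sq_sqrt hx]
  cases k with
  | zero =>
    simp
    ring
  | succ k =>
    have e : (√((k + 1 : ℕ) + 1 : ℝ) : ℂ) * ((-Complex.I) ^ (k + 1 + 1) * a (k + 1 + 1)) +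
        (√((k + 1 : ℕ) : ℝ) : ℂ) * ((-Complex.I) ^ (k + 1 - 1) * a (k + 1 - 1)) =
        (-Complex.I) ^ k * -((√((k + 1 : ℕ) + 1 : ℝ) : ℂ) * a (k + 1 + 1) -
          (√((k + 1 : ℕ) : ℝ) : ℂ) * a (k + 1 - 1)) := by
      rw [Nat.add_sub_cancel, pow_succ, pow_succ]
      linear_combination ((√((k + 1 : ℕ) + 1 : ℝ) : ℂ) * (-Complex.I) ^ k * a (k + 1 + 1)) *
        Complex.I_sq
    have hp := parallelogram_law_with_norm ℝ ((√((k + 1 : ℕ) + 1 : ℝ) : ℂ) * a (k + 1 + 1))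
      ((√((k + 1 : ℕ) : ℝ) : ℂ) * a (k + 1 - 1))
    rw [e, norm_mul, norm_pow, norm_neg, Complex.norm_I, one_pow, one_mul, norm_neg,
      ← hnorm _ _ (by positivity), ← hnorm _ _ (by positivity)]
    linarith

/-- Nonnegativity lets the series be split. After shifting the indices, `x k` receives `k` from one
part and `k + 1` from the other. -/
theorem hasSum_two_mul_add_one_mul {x : ℕ → ℝ} (hx : ∀ k, 0 ≤ x k) {E : ℝ}
    (h : HasSum (fun k : ℕ => (k + 1) * x (k + 1) + k * x (k - 1)) E) :
    HasSum (fun k : ℕ => (2 * k + 1) * x k) E := by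
  have hb : Summable (fun k : ℕ => ((k : ℝ) + 1) * x (k + 1)) :=
    h.summable.of_nonneg_of_le (fun k => mul_nonneg (by positivity) (hx _))
      fun k => le_add_of_nonneg_right (mul_nonneg (by positivity) (hx _))
  have hc : Summable (fun k : ℕ => (k : ℝ) * x (k - 1)) :=
    h.summable.of_nonneg_of_le (fun k => mul_nonneg (by positivity) (hx _))
      fun k => le_add_of_nonneg_left (mul_nonneg (by positivity) (hx _))
  obtain ⟨B, hB⟩ := hb
  obtain ⟨C, hC⟩ := hc
  have hE := h.unique (hB.add hC)
  have hB' : HasSum (fun k : ℕ => (k : ℝ) * x k) B := by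
    rw [← hasSum_nat_add_iff' 1]
    simpa using hB
  have hC' : HasSum (fun k : ℕ => ((k : ℝ) + 1) * x k) C := by
    rw [← hasSum_nat_add_iff' 1] at hC
    simpa using hC
  rw [hE]
  convert! hB'.add hC' using 2 with k
  ring

theorem hasSum_sq_norm_coeff_of_moments {f : L2R}
    (h : Integrable (fun t : ℝ => t ^ 2 * ‖f t‖ ^ 2))
    (h' : Integrable (fun t : ℝ => t ^ 2 * ‖(𝓕 f : L2R) t‖ ^ 2)) :
    HasSum (fun k : ℕ => (2 * k + 1) * ‖inner ℂ (hermiteL2 k) f‖ ^ 2)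
      (2 * Real.pi * ((∫ t : ℝ, t ^ 2 * ‖f t‖ ^ 2) + ∫ t : ℝ, t ^ 2 * ‖(𝓕 f : L2R) t‖ ^ 2)) := by
  refine hasSum_two_mul_add_one_mul (fun k => sq_nonneg _) ?_
  have hs := ((hasSum_sq_norm_mulX_coeff h).add (hasSum_sq_norm_mulX_coeff h')).mul_left (1 / 2)
  simp_rw [inner_hermiteL2_fourier,
    sq_norm_add_sq_norm_coeff (fun k => inner ℂ (hermiteL2 k) f)] at hs
  convert! hs using 1
  · ext k
    ring
  · ring

/-- The sum of variances and squared means of `f` and its Fourier transform. -/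
noncomputable def L2R.dispersion (f : L2R) : ℝ≥0∞ :=
  L2R.variance f + L2R.variance (𝓕 f) + ENNReal.ofReal (|L2R.mean f| ^ 2) +
    ENNReal.ofReal (|L2R.mean (𝓕 f)| ^ 2)

theorem L2R.dispersion_eq_top_or_hasSum {f : L2R} (hf : ‖f‖ = 1) :
    L2R.dispersion f = ∞ ∨ ∃ E : ℝ, 0 ≤ E ∧ L2R.dispersion f = ENNReal.ofReal (E / (2 * Real.pi)) ∧
      HasSum (fun k : ℕ => (2 * k + 1) * ‖inner ℂ (hermiteL2 k) f‖ ^ 2) E := by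
  by_cases h : L2R.variance f = ∞
  · left; simp [L2R.dispersion, h]
  by_cases h' : L2R.variance (𝓕 f) = ∞
  · left; simp [L2R.dispersion, h']
  right
  have hf' : ‖(𝓕 f : L2R)‖ = 1 := by rw [Lp.norm_fourier_eq, hf]
  have hs := hasSum_sq_norm_coeff_of_moments (L2R.integrable_sq_mul_sq_norm h)
    (L2R.integrable_sq_mul_sq_norm h')
  refine ⟨_, hs.nonneg fun k => by positivity, ?_, hs⟩
  have e : L2R.dispersion f = (L2R.variance f + ENNReal.ofReal (|L2R.mean f| ^ 2)) +
      (L2R.variance (𝓕 f) + ENNReal.ofReal (|L2R.mean (𝓕 f)| ^ 2)) := by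
    rw [L2R.dispersion]
    ring
  rw [e, L2R.variance_add_sq_mean hf h, L2R.variance_add_sq_mean hf' h',
    ← ENNReal.ofReal_add (integral_nonneg fun t => by positivity)
      (integral_nonneg fun t => by positivity)]
  congr 1
  have := Real.pi_ne_zero
  field_simp

/-! ### The mean-dispersion principle -/

theorem sum_range_two_mul_add_one_sub (N : ℕ) :
    ∑ k ∈ Finset.range N, ((2 * k + 1 : ℝ) - 2 * N) = -(N : ℝ) ^ 2 := by
  have h : ∀ M : ℕ, ∑ k ∈ Finset.range M, ((2 * k + 1 : ℝ) - 2 * N) = (M : ℝ) ^ 2 - 2 * N * M := by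
    intro M
    induction M with
    | zero => simp
    | succ M ih =>
      rw [Finset.sum_range_succ, ih]
      push_cast
      ring
  rw [h]
  ring

/-- Subtracting `2N` times the mass makes the coefficient `2k + 1 - 2N` negative exactly when `k <
N`. Dropping the terms with `k ≥ N` and replacing `a k` by `1` in the others both lower the sum,
leaving `-N²`. -/
theorem sq_le_of_hasSum_two_mul_add_one_mul {a : ℕ → ℝ} {N : ℕ} {E : ℝ} (h0 : ∀ k, 0 ≤ a k)
    (h1 : ∀ k, a k ≤ 1) (hN : HasSum a N)
    (hE : HasSum (fun k : ℕ => (2 * k + 1) * a k) E) : (N : ℝ) ^ 2 ≤ E := by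
  have hs : HasSum (fun k : ℕ => ((2 * k + 1 : ℝ) - 2 * N) * a k) (E - 2 * N * N) := by
    convert! hE.sub (hN.mul_left (2 * N : ℝ)) using 2 with k
    ring
  have hle := sum_le_hasSum (Finset.range N) (fun k hk => mul_nonneg (by
    have : (N : ℝ) ≤ k := by exact_mod_cast not_lt.1 (mt Finset.mem_range.2 hk)
    linarith) (h0 k)) hs
  have hge : ∑ k ∈ Finset.range N, ((2 * k + 1 : ℝ) - 2 * N) ≤
      ∑ k ∈ Finset.range N, ((2 * k + 1 : ℝ) - 2 * N) * a k := by
    refine Finset.sum_le_sum fun k hk => ?_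
    have : (k : ℝ) + 1 ≤ N := by exact_mod_cast Finset.mem_range.1 hk
    nlinarith [h1 k]
  rw [sum_range_two_mul_add_one_sub] at hge
  nlinarith

theorem sq_div_le_sum_dispersion {e : ℕ → L2R} (he : Orthonormal ℂ e) (N : ℕ) :
    ENNReal.ofReal ((N : ℝ) ^ 2 / (2 * Real.pi)) ≤
      ∑ k ∈ Finset.range N, L2R.dispersion (e k) := by
  by_cases htop : ∃ k ∈ Finset.range N, L2R.dispersion (e k) = ∞
  · rw [ENNReal.sum_eq_top.2 htop]
    exact le_top
  push Not at htop
  have hE : ∀ k, ∃ E : ℝ, k ∈ Finset.range N → 0 ≤ E ∧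
      L2R.dispersion (e k) = ENNReal.ofReal (E / (2 * Real.pi)) ∧
      HasSum (fun j : ℕ => (2 * j + 1) * ‖inner ℂ (hermiteL2 j) (e k)‖ ^ 2) E := fun k => by
    by_cases hk : k ∈ Finset.range N
    · obtain ⟨E, hE⟩ := (L2R.dispersion_eq_top_or_hasSum (he.1 k)).resolve_left (htop k hk)
      exact ⟨E, fun _ => hE⟩
    -- A dummy energy: finiteness is known only for the indices in the sum.
    · exact ⟨0, fun h => absurd h hk⟩
  choose E hE using hE
  rw [Finset.sum_congr rfl fun k hk => (hE k hk).2.1,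
    ← ENNReal.ofReal_sum_of_nonneg fun k hk => div_nonneg (hE k hk).1 (by positivity),
    ← Finset.sum_div]
  refine ENNReal.ofReal_le_ofReal (div_le_div_of_nonneg_right ?_ (by positivity))
  refine sq_le_of_hasSum_two_mul_add_one_mul
    (a := fun j => ∑ k ∈ Finset.range N, ‖inner ℂ (hermiteL2 j) (e k)‖ ^ 2)
    (fun j => Finset.sum_nonneg fun k _ => sq_nonneg _) (fun j => ?_) ?_ ?_
  -- Bessel's inequality for the unit vector `h_j` against the system `e` bounds the weight by `1`.
  · have := he.sum_inner_products_le (x := hermiteL2 j) (s := Finset.range N)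
    rw [orthonormal_hermiteL2.1 j, one_pow] at this
    simpa only [norm_inner_symm] using this
  · have := hasSum_sum (s := Finset.range N)
      fun k _ => hasSum_sq_norm_inner_hermiteL2 (e k)
    simpa [he.1] using this
  · simp_rw [Finset.mul_sum]
    exact hasSum_sum fun k hk => (hE k hk).2.2

/-- The excess energy `∑ (2j - 2n) |⟨h_j, f⟩|²` is zero, and orthogonality to the lower levels makes
every term nonnegative. All coefficients except the `n`-th therefore vanish, and completeness
identifies `f`. -/
theorem exists_eq_smul_hermiteL2 {f : L2R} (hf : ‖f‖ = 1) {n : ℕ}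
    (horth : ∀ j < n, inner ℂ (hermiteL2 j) f = 0)
    (hd : L2R.dispersion f = ENNReal.ofReal ((2 * n + 1) / (2 * Real.pi))) :
    ∃ c : ℂ, ‖c‖ = 1 ∧ f = c • hermiteL2 n := by
  obtain ⟨E, hE0, hE, hs⟩ := (L2R.dispersion_eq_top_or_hasSum hf).resolve_left
    (by rw [hd]; exact ENNReal.ofReal_ne_top)
  have hEn : E = 2 * n + 1 := by
    rw [hd, ENNReal.ofReal_eq_ofReal_iff (by positivity) (by positivity)] at hE
    have := Real.pi_ne_zero
    field_simp at hE
    linarith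
  have h1 := hasSum_sq_norm_inner_hermiteL2 f
  rw [hf] at h1
  have hz : HasSum (fun j : ℕ => ((2 * j + 1 : ℝ) - (2 * n + 1)) *
      ‖inner ℂ (hermiteL2 j) f‖ ^ 2) 0 := by
    convert! hs.sub (h1.mul_left (2 * n + 1 : ℝ)) using 1
    · ext j
      ring
    · rw [hEn]
      ring
  have hnn : ∀ j : ℕ, 0 ≤ ((2 * j + 1 : ℝ) - (2 * n + 1)) * ‖inner ℂ (hermiteL2 j) f‖ ^ 2 := by
    intro j
    rcases lt_or_ge j n with hj | hj
    · simp [horth j hj]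
    · have : (n : ℝ) ≤ j := by exact_mod_cast hj
      exact mul_nonneg (by linarith) (sq_nonneg _)
  have hzero := (hasSum_zero_iff_of_nonneg hnn).1 hz
  have hne : ∀ j, j ≠ n → inner ℂ (hermiteL2 j) f = 0 := fun j hj => by
    have := congrFun hzero j
    have hj' : ((2 * j + 1 : ℝ) - (2 * n + 1)) ≠ 0 := fun h => hj (by
      have : (j : ℝ) = n := by linarith
      exact_mod_cast this)
    simpa using (mul_eq_zero.1 this).resolve_left hj'
  have hfeq : f = inner ℂ (hermiteL2 n) f • hermiteL2 n := by
    rw [← sub_eq_zero]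
    refine eq_zero_of_forall_inner_hermiteL2_eq_zero fun j => ?_
    rw [← inner_conj_symm, inner_sub_right, inner_smul_right,
      orthonormal_iff_ite.1 orthonormal_hermiteL2 j n]
    by_cases hj : j = n
    · subst hj; simp
    · simp [hj, hne j hj]
  refine ⟨_, ?_, hfeq⟩
  have := congrArg norm hfeq
  rw [norm_smul, orthonormal_hermiteL2.1 n, mul_one, hf] at this
  exact this.symm

theorem dispersion_eq_of_sum_eq {e : ℕ → L2R} {n : ℕ}
    (h : ∀ m ≤ n, ∑ k ∈ Finset.range (m + 1), L2R.dispersion (e k) =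
      ENNReal.ofReal (((m : ℝ) + 1) ^ 2 / (2 * Real.pi))) :
    L2R.dispersion (e n) = ENNReal.ofReal ((2 * n + 1) / (2 * Real.pi)) := by
  cases n with
  | zero => simpa using h 0 le_rfl
  | succ n =>
    have h1 := h n (Nat.le_succ n)
    have h2 := h (n + 1) le_rfl
    rw [Finset.sum_range_succ, h1] at h2
    -- The increment is `(n+2)² - (n+1)² = 2(n+1) + 1`; cancelling in `ℝ≥0∞` is allowed because the
    -- earlier partial sum is finite.
    have h3 : ENNReal.ofReal ((((n + 1 : ℕ) : ℝ) + 1) ^ 2 / (2 * Real.pi)) =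
        ENNReal.ofReal (((n : ℝ) + 1) ^ 2 / (2 * Real.pi)) +
          ENNReal.ofReal ((2 * (n + 1 : ℕ) + 1) / (2 * Real.pi)) := by
      rw [← ENNReal.ofReal_add (by positivity) (by positivity)]
      congr 1
      push_cast
      ring
    rw [h3] at h2
    exact (ENNReal.add_right_inj ENNReal.ofReal_ne_top).1 h2

theorem eq_smul_hermiteL2_of_sum_dispersion_eq {e : ℕ → L2R} (he : Orthonormal ℂ e) {n₀ : ℕ}
    (h : ∀ n ≤ n₀, ∑ k ∈ Finset.range (n + 1), L2R.dispersion (e k) =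
      ENNReal.ofReal (((n : ℝ) + 1) ^ 2 / (2 * Real.pi))) (k : ℕ) (hk : k ≤ n₀) :
    ∃ c : ℂ, ‖c‖ = 1 ∧ e k = c • hermiteL2 k := by
  induction k using Nat.strong_induction_on with
  | _ k ih =>
    refine exists_eq_smul_hermiteL2 (he.1 k) (fun j hj => ?_)
      (dispersion_eq_of_sum_eq fun m hm => h m (hm.trans hk))
    obtain ⟨c, hc, hce⟩ := ih j hj (hj.le.trans hk)
    have horth := he.2 hj.ne
    simp only [hce, inner_smul_left] at horth
    -- Since `e j = c h_j` with `c ≠ 0`, orthogonality to `e j` passes to `h_j`.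
    refine (mul_eq_zero.1 horth).resolve_left fun h0 => ?_
    rw [map_eq_zero] at h0
    simp [h0] at hc

theorem mainTheorem1 (e : ℕ → L2R) (he : Orthonormal ℂ e) :
    (∀ n : ℕ, ENNReal.ofReal (((n : ℝ) + 1) ^ 2 / (2 * Real.pi)) ≤
      ∑ k ∈ Finset.range (n + 1),
        (L2R.variance (e k) + L2R.variance (𝓕 (e k)) +
          ENNReal.ofReal (|L2R.mean (e k)| ^ 2) + ENNReal.ofReal (|L2R.mean (𝓕 (e k))| ^ 2))) ∧
    (∀ n₀ : ℕ,
      (∀ n : ℕ, n ≤ n₀ →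
        ∑ k ∈ Finset.range (n + 1),
          (L2R.variance (e k) + L2R.variance (𝓕 (e k)) +
            ENNReal.ofReal (|L2R.mean (e k)| ^ 2) + ENNReal.ofReal (|L2R.mean (𝓕 (e k))| ^ 2)) =
          ENNReal.ofReal (((n : ℝ) + 1) ^ 2 / (2 * Real.pi))) →
      ∀ k : ℕ, k ≤ n₀ → ∃ c : ℂ, ‖c‖ = 1 ∧
        ∀ᵐ t : ℝ ∂volume, e k t = c * (hermiteFunction k t : ℂ)) := by
  refine ⟨fun n => ?_, fun n₀ h k hk => ?_⟩
  · have := sq_div_le_sum_dispersion he (n + 1)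
    push_cast at this
    exact this
  · obtain ⟨c, hc, hce⟩ := eq_smul_hermiteL2_of_sum_dispersion_eq he h k hk
    refine ⟨c, hc, ?_⟩
    rw [hce]
    filter_upwards [Lp.coeFn_smul c (hermiteL2 k), hermiteL2_ae k] with t h1 h2
    rw [h1, Pi.smul_apply, h2, smul_eq_mul]
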